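/- Let $d,n\in\mathbb N$, let $\mathbb T^d=\mathbb R^d/\mathbb Z^d$, and let $\omega\in\mathbb R^d$ be rationally independent, i.e. $\langle k,\omega\rangle\ne 0$ for all $k\in\mathbb Z^d\setminus\{0\}$. For a $C^\infty$ map $A:\mathbb T^d\to\mathcal M(n,\mathbb C)$ let $X_{\omega,A}:\mathbb R\times\mathbb T^d\to GL(n,\mathbb C)$ be the quasi-periodic cocycle of $A$, i.e. the solution of $\frac{d}{dt}X^t_{\omega,A}(\theta)=A(\theta+t\omega)X^t_{\omega,A}(\theta)$, $X^0_{\omega,A}(\theta)=I$. The cocycle is called real if $A$ is real-valued, and constant if $A$ is constant. A conjugation between $X_{\omega,A}$ and $X_{\omega,B}$ is a $C^\infty$ map $Z:\mathbb T^d\to GL(n,\mathbb C)$ with $X^t_{\omega,A}(\theta)=Z(\theta+t\omega)X^t_{\omega,B}(\theta)Z(\theta)^{-1}$ for all $t\in\mathbb R$, $\theta\in\mathbb T^d$. A cocycle is reducible if there is a conjugation between it and some constant cocycle; it is real reducible if it is real and there is a real-valued conjugation between it and some constant cocycle. Theorem. Let $A:\mathbb T^d\to\mathcal M(n,\mathbb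 R)$ be $C^\infty$. If the real cocycle $X_{\omega,A}$ is reducible, then the cocycle $X_{\omega/2,A_2}$, where $A_2(\theta)=A(2\theta)$ for $\theta\in\mathbb T^d$, is real reducible. Hence there are a $C^\infty$ map $Z:\mathbb T^d\to GL(n,\mathbb R)$ and a constant matrix $B\in\mathcal M(n,\mathbb R)$ such that $$\partial_{\omega/2}Z(\theta)=A(2\theta)Z(\theta)-Z(\theta)B\qquad\text{for all }\theta\in\mathbb T^d,$$ where $\partial_{\omega/2}Z(\theta)=\frac{d}{dt}Z(\theta+t\omega/2)\big|_{t=0}$. No arithmetic condition on $\omega$ beyond rational independence is required. -/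

import Mathlib

open scoped MatrixGroups

/-- The torus `𝕋^d = ℝ^d / ℤ^d`. -/
abbrev Torus (d : ℕ) : Type := UnitAddTorus (Fin d)

namespace Torus

/-- The projection `ℝ^d → 𝕋^d`. -/
def proj {d : ℕ} (x : Fin d → ℝ) : Torus d := fun i => (x i : UnitAddCircle)

/-- The translate `θ + tω` of the point `θ` of the torus. -/
def flow {d : ℕ} (ω : Fin d → ℝ) (t : ℝ) (θ : Torus d) : Torus d := θ + proj (t • ω)

end Torus

/-- `ω ∈ ℝ^d` is rationally independent: `⟨k, ω⟩ ≠ 0` for every nonzero `k ∈ ℤ^d`. -/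
def RationallyIndependent {d : ℕ} (ω : Fin d → ℝ) : Prop :=
  ∀ k : Fin d → ℤ, k ≠ 0 → ∑ i, (k i : ℝ) * ω i ≠ 0

/-- A matrix-valued map on the torus is of class `C^∞`: each entry lifts to a `C^∞` function
on `ℝ^d`. -/
def SmoothOnTorus {𝕜 : Type} [RCLike 𝕜] {d n : ℕ}
    (F : Torus d → Matrix (Fin n) (Fin n) 𝕜) : Prop :=
  ∀ i j, ContDiff ℝ (⊤ : ℕ∞) (fun x : Fin d → ℝ => F (Torus.proj x) i j)

/-- `F` is differentiable at `θ` in the direction `ω`, and the directional derivative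
`∂_ω F(θ) = d/dt F(θ + tω) |_{t=0}` is the matrix `M`. -/
def HasDirDerivAt {d n : ℕ} (ω : Fin d → ℝ)
    (F : Torus d → Matrix (Fin n) (Fin n) ℝ) (M : Matrix (Fin n) (Fin n) ℝ) (θ : Torus d) : Prop :=
  ∀ i j, HasDerivAt (fun t : ℝ => F (Torus.flow ω t θ) i j) (M i j) 0

/-- `X` is the quasi-periodic cocycle `X_{ω,A}`: the (unique) solution of
`d/dt X^t(θ) = A(θ + tω) X^t(θ)`, `X^0(θ) = I`, for all `θ ∈ 𝕋^d` and `t ∈ ℝ`. -/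
structure IsCocycle {d n : ℕ} (ω : Fin d → ℝ) (A : Torus d → Matrix (Fin n) (Fin n) ℂ)
    (X : ℝ → Torus d → Matrix (Fin n) (Fin n) ℂ) : Prop where
  zero : ∀ θ, X 0 θ = 1
  deriv : ∀ θ t i j,
    HasDerivAt (fun s : ℝ => X s θ i j) ((A (Torus.flow ω t θ) * X t θ) i j) t

/-- `Z : 𝕋^d → GL(n, ℂ)`, of class `C^∞`, is a conjugation between the cocycles `X_{ω,A}` and
`X_{ω,B}`: `X_{ω,A}^t(θ) = Z(θ + tω) X_{ω,B}^t(θ) Z(θ)⁻¹` for all `t` and `θ`. -/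
def IsConjugation {d n : ℕ} (ω : Fin d → ℝ) (A B : Torus d → Matrix (Fin n) (Fin n) ℂ)
    (Z : Torus d → GL (Fin n) ℂ) : Prop :=
  SmoothOnTorus (fun θ => (Z θ : Matrix (Fin n) (Fin n) ℂ)) ∧
  ∃ X Y : ℝ → Torus d → Matrix (Fin n) (Fin n) ℂ, IsCocycle ω A X ∧ IsCocycle ω B Y ∧
    ∀ t θ, X t θ = (Z (Torus.flow ω t θ) : Matrix (Fin n) (Fin n) ℂ) * Y t θ *
      ((Z θ)⁻¹ : GL (Fin n) ℂ)

/-- All values of the matrix-valued map `F` are real matrices. -/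
def IsRealValued {d n : ℕ} (F : Torus d → Matrix (Fin n) (Fin n) ℂ) : Prop :=
  ∀ θ i j, (F θ i j).im = 0

/-- The cocycle `X_{ω,A}` is reducible: it is conjugated to a constant cocycle. -/
def Reducible {d n : ℕ} (ω : Fin d → ℝ) (A : Torus d → Matrix (Fin n) (Fin n) ℂ) : Prop :=
  ∃ (B : Matrix (Fin n) (Fin n) ℂ) (Z : Torus d → GL (Fin n) ℂ),
    IsConjugation ω A (fun _ => B) Z

/-- The cocycle `X_{ω,A}` is real reducible: it is real, and it is conjugated to a constant
cocycle by a real conjugation. -/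
def RealReducible {d n : ℕ} (ω : Fin d → ℝ) (A : Torus d → Matrix (Fin n) (Fin n) ℂ) : Prop :=
  IsRealValued A ∧
  ∃ (B : Matrix (Fin n) (Fin n) ℂ) (Z : Torus d → GL (Fin n) ℂ),
    IsRealValued (fun θ => (Z θ : Matrix (Fin n) (Fin n) ℂ)) ∧
    IsConjugation ω A (fun _ => B) Z

open scoped Matrix.Norms.Operator ComplexConjugate

open MeasureTheory

namespace Torus

variable {d n : ℕ}

lemma flow_zero (ω : Fin d → ℝ) (θ : Torus d) : flow ω 0 θ = θ := by
  ext i; simp [flow, proj]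

lemma flow_add (ω : Fin d → ℝ) (s t : ℝ) (θ : Torus d) :
    flow ω (s + t) θ = flow ω s (flow ω t θ) := by
  ext i; simp [flow, proj, add_mul]; abel

lemma two_nsmul_flow_half (ω : Fin d → ℝ) (t : ℝ) (θ : Torus d) :
    (2 : ℕ) • flow ((1 / 2 : ℝ) • ω) t θ = flow ω t ((2 : ℕ) • θ) := by
  ext i
  simp only [flow, proj, smul_add, Pi.add_apply, Pi.smul_apply, smul_eq_mul]
  rw [← AddCircle.coe_nsmul]
  congr 2
  simp; ring

lemma proj_add (x y : Fin d → ℝ) : proj (x + y) = proj x + proj y := by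
  ext i; simp [proj]

lemma isOpenQuotientMap_proj : IsOpenQuotientMap (proj : (Fin d → ℝ) → Torus d) :=
  IsOpenQuotientMap.piMap fun _ => QuotientAddGroup.isOpenQuotientMap_mk

lemma proj_surjective : Function.Surjective (proj : (Fin d → ℝ) → Torus d) :=
  isOpenQuotientMap_proj.surjective

lemma flow_proj (ω : Fin d → ℝ) (t : ℝ) (x : Fin d → ℝ) :
    flow ω t (proj x) = proj (x + t • ω) := (proj_add _ _).symm

lemma mFourier_proj (k : Fin d → ℤ) (x : Fin d → ℝ) :
    UnitAddTorus.mFourier k (proj x)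
      = Complex.exp (2 * Real.pi * Complex.I * ∑ i, (k i : ℝ) * x i) := by
  simp only [UnitAddTorus.mFourier, proj, ContinuousMap.coe_mk, fourier_coe_apply]
  rw [← Complex.exp_sum, Complex.ofReal_sum, Finset.mul_sum]
  congr 1
  refine Finset.sum_congr rfl fun i _ => ?_
  push_cast
  ring

lemma mFourier_add_right (k : Fin d → ℤ) (θ η : Torus d) :
    UnitAddTorus.mFourier k (θ + η) = UnitAddTorus.mFourier k θ * UnitAddTorus.mFourier k η := by
  obtain ⟨x, rfl⟩ := proj_surjective θ
  obtain ⟨y, rfl⟩ := proj_surjective η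
  rw [← proj_add]
  simp only [mFourier_proj, ← Complex.exp_add, Pi.add_apply, mul_add, Finset.sum_add_distrib,
    Complex.ofReal_add]

lemma mFourier_flow (k : Fin d → ℤ) (ω : Fin d → ℝ) (t : ℝ) (θ : Torus d) :
    UnitAddTorus.mFourier k (flow ω t θ)
      = Complex.exp (t * (2 * Real.pi * Complex.I * (∑ i, (k i : ℝ) * ω i : ℝ)))
        * UnitAddTorus.mFourier k θ := by
  rw [flow, mFourier_add_right, mFourier_proj, mul_comm]
  congr 2
  simp only [Complex.ofReal_sum, Finset.mul_sum]
  refine Finset.sum_congr rfl fun i _ => ?_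
  simp
  ring

lemma mFourier_two_nsmul (k : Fin d → ℤ) (θ : Torus d) :
    UnitAddTorus.mFourier k ((2 : ℕ) • θ) = UnitAddTorus.mFourier (k + k) θ := by
  rw [two_nsmul, mFourier_add_right, UnitAddTorus.mFourier_add]

lemma hasDerivAt_mFourier_flow (k : Fin d → ℤ) (ω : Fin d → ℝ) (θ : Torus d) :
    HasDerivAt (fun t : ℝ => UnitAddTorus.mFourier k (flow ω t θ))
      ((2 * Real.pi * Complex.I * (∑ i, (k i : ℝ) * ω i : ℝ)) * UnitAddTorus.mFourier k θ) 0 := by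
  simp only [mFourier_flow]
  have h := (((Complex.ofRealCLM.hasDerivAt (x := (0 : ℝ))).mul_const
    (2 * Real.pi * Complex.I * (∑ i, (k i : ℝ) * ω i : ℝ))).cexp).mul_const
      (UnitAddTorus.mFourier k θ)
  simpa using h

lemma contDiff_mFourier_proj (k : Fin d → ℤ) :
    ContDiff ℝ (⊤ : ℕ∞) (fun x : Fin d → ℝ => UnitAddTorus.mFourier k (proj x)) := by
  simp only [mFourier_proj]
  have h : ContDiff ℝ (⊤ : ℕ∞) fun x : Fin d → ℝ => ∑ i, (k i : ℝ) * x i :=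
    ContDiff.sum fun i _ => contDiff_const.mul (contDiff_apply ℝ ℝ i)
  exact (contDiff_const.mul (Complex.ofRealCLM.contDiff.comp h)).cexp

lemma hasDerivAt_flow_of_zero {E : Type*} [NormedAddCommGroup E] [NormedSpace ℝ E]
    {ω : Fin d → ℝ} {F F' : Torus d → E}
    (h : ∀ θ, HasDerivAt (fun t : ℝ => F (flow ω t θ)) (F' θ) 0) (θ : Torus d) (t : ℝ) :
    HasDerivAt (fun s : ℝ => F (flow ω s θ)) (F' (flow ω t θ)) t := by
  have h1 := h (flow ω t θ)
  rw [← sub_self t] at h1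
  have h2 := HasDerivAt.comp_sub_const t t h1
  simpa only [← flow_add, sub_add_cancel] using h2

end Torus

lemma Matrix.hasDerivAt_iff {𝕜 : Type} [RCLike 𝕜] {n : ℕ}
    {F : ℝ → Matrix (Fin n) (Fin n) 𝕜} {F' : Matrix (Fin n) (Fin n) 𝕜} {t : ℝ} :
    HasDerivAt F F' t ↔ ∀ i j, HasDerivAt (fun s => F s i j) (F' i j) t := by
  refine (hasDerivAt_pi (φ := F) (φ' := F')).trans (forall_congr' fun i => ?_)
  exact hasDerivAt_pi

lemma HasDerivAt.units_inv {R : Type*} [NormedRing R] [NormedAlgebra ℝ R] [CompleteSpace R]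
    {Z : ℝ → Rˣ} {Z' : R} {t : ℝ} (h : HasDerivAt (fun s => (Z s : R)) Z' t) :
    HasDerivAt (fun s => ((Z s)⁻¹ : Rˣ).val)
      (-(((Z t)⁻¹ : Rˣ) * Z' * ((Z t)⁻¹ : Rˣ))) t := by
  have := (hasFDerivAt_ringInverse (𝕜 := ℝ) (Z t)).comp_hasDerivAt t h
  simpa [Function.comp_def] using this

namespace SmoothOnTorus

variable {d n : ℕ} {𝕜 : Type} [RCLike 𝕜] {F G : Torus d → Matrix (Fin n) (Fin n) 𝕜}

lemma continuous (hF : SmoothOnTorus F) : Continuous F := by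
  rw [← Torus.isOpenQuotientMap_proj.continuous_comp_iff]
  exact continuous_matrix fun i j => (hF i j).continuous

lemma differentiableAt_flow (hF : SmoothOnTorus F) (ω : Fin d → ℝ) (θ : Torus d) (t : ℝ) :
    DifferentiableAt ℝ (fun t : ℝ => F (Torus.flow ω t θ)) t := by
  obtain ⟨x, rfl⟩ := Torus.proj_surjective θ
  have h : ∀ i j, DifferentiableAt ℝ (fun t : ℝ => F (Torus.flow ω t (Torus.proj x)) i j) t := by
    intro i j
    simp only [Torus.flow_proj]
    exact ((hF i j).differentiable (by simp)).differentiableAt.fun_comp' t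
      (f := fun s : ℝ => x + s • ω) (by fun_prop)
  exact (Matrix.hasDerivAt_iff (F' := Matrix.of fun i j => deriv _ t).2
    fun i j => (h i j).hasDerivAt).differentiableAt

lemma mul (hF : SmoothOnTorus F) (hG : SmoothOnTorus G) : SmoothOnTorus (fun θ => F θ * G θ) := by
  intro i j
  simp only [Matrix.mul_apply]
  exact ContDiff.sum fun k _ => (hF i k).mul (hG k j)

lemma const (M : Matrix (Fin n) (Fin n) 𝕜) : SmoothOnTorus (fun _ : Torus d => M) :=
  fun _ _ => contDiff_const

lemma two_nsmul (hF : SmoothOnTorus F) : SmoothOnTorus (fun θ => F ((2 : ℕ) • θ)) := by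
  intro i j
  have h : ∀ x : Fin d → ℝ, (2 : ℕ) • Torus.proj x = Torus.proj ((2 : ℝ) • x) := fun x => by
    rw [_root_.two_nsmul, ← Torus.proj_add, two_smul]
  simp only [h]
  exact (hF i j).comp (contDiff_const_smul (2 : ℝ))

end SmoothOnTorus

/-- The Jordan form of a complex matrix up to the shape of its nilpotent part. -/
lemma Matrix.exists_conj_eq_diagonal_add_isNilpotent {n : ℕ} (B : Matrix (Fin n) (Fin n) ℂ) :
    ∃ (T : GL (Fin n) ℂ) (l : Fin n → ℂ) (N : Matrix (Fin n) (Fin n) ℂ), IsNilpotent N ∧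
      (∀ i j, N i j ≠ 0 → l i = l j) ∧ B * T = T * (Matrix.diagonal l + N) := by
  classical
  set f : Module.End ℂ (Fin n → ℂ) := Matrix.toLin' B with hf
  have hint : DirectSum.IsInternal fun μ : ℂ => f.maxGenEigenspace μ :=
    (DirectSum.isInternal_submodule_iff_iSupIndep_and_iSup_eq_top _).2
      ⟨f.independent_maxGenEigenspace, f.iSup_maxGenEigenspace_eq_top⟩
  let v := fun μ : ℂ => Module.finBasis ℂ (f.maxGenEigenspace μ)
  let b₀ := hint.collectedBasis v
  have hfin : Finite (Σ μ : ℂ, Fin (Module.finrank ℂ (f.maxGenEigenspace μ))) :=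
    Module.Finite.finite_basis b₀
  have := Fintype.ofFinite (Σ μ : ℂ, Fin (Module.finrank ℂ (f.maxGenEigenspace μ)))
  have hcard : Fintype.card (Σ μ : ℂ, Fin (Module.finrank ℂ (f.maxGenEigenspace μ))) = n := by
    rw [← Module.finrank_eq_card_basis b₀, Module.finrank_fin_fun]
  let e := Fintype.equivFinOfCardEq hcard
  let b := b₀.reindex e
  let l : Fin n → ℂ := fun i => (e.symm i).1
  have hmem : ∀ j, b j ∈ f.maxGenEigenspace (l j) := fun j => by
    rw [Module.Basis.reindex_apply]
    exact hint.collectedBasis_mem v (e.symm j)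
  have hrepr : ∀ μ, ∀ x ∈ f.maxGenEigenspace μ, ∀ i, b.repr x i ≠ 0 → l i = μ := by
    intro μ x hx i hi
    by_contra hne
    refine hi ?_
    simp only [b, Module.Basis.repr_reindex_apply]
    exact hint.collectedBasis_repr_of_mem_ne v (Ne.symm hne) hx
  have hmaps : ∀ μ ν, ∀ x ∈ f.maxGenEigenspace μ,
      (f - algebraMap ℂ _ ν) x ∈ f.maxGenEigenspace μ := fun μ ν =>
    Module.End.mapsTo_maxGenEigenspace_of_comm
      ((Commute.refl f).sub_right (Algebra.commutes' ν f).symm) μ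
  let S : Module.End ℂ (Fin n → ℂ) := Matrix.toLin b b (Matrix.diagonal l)
  have hS : ∀ j, S (b j) = l j • b j := fun j => by
    simp [S, Matrix.toLin_self, Matrix.diagonal_apply, ite_smul]
  have hSmem : ∀ μ, ∀ x ∈ f.maxGenEigenspace μ, S x = μ • x := by
    intro μ x hx
    conv_lhs => rw [← b.sum_repr x]
    conv_rhs => rw [← b.sum_repr x]
    simp only [map_sum, map_smul, hS, Finset.smul_sum]
    refine Finset.sum_congr rfl fun i _ => ?_
    by_cases h0 : b.repr x i = 0
    · simp [h0]
    · rw [hrepr μ x hx i h0, smul_comm]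
  have hpow : ∀ k μ, ∀ x ∈ f.maxGenEigenspace μ,
      ((f - S) ^ k) x = ((f - algebraMap ℂ _ μ) ^ k) x := by
    intro k
    induction k with
    | zero => intros; simp
    | succ k ih =>
      intro μ x hx
      have h1 : (f - S) x = (f - algebraMap ℂ (Module.End ℂ (Fin n → ℂ)) μ) x := by
        simp [hSmem μ x hx]
      rw [pow_succ, pow_succ, Module.End.mul_apply, Module.End.mul_apply, h1,
        ih μ _ (hmaps μ μ x hx)]
  have hnil : (f - S) ^ n = 0 := by
    refine b.ext fun j => ?_
    rw [hpow n (l j) _ (hmem j)]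
    have := hmem j
    rw [Module.End.maxGenEigenspace_eq_genEigenspace_finrank, Module.finrank_fin_fun,
      Module.End.mem_genEigenspace_nat] at this
    simpa [LinearMap.mem_ker, Algebra.algebraMap_eq_smul_one] using this
  have hT1 := b.toMatrix_mul_toMatrix_flip (Pi.basisFun ℂ (Fin n))
  have hT2 := (Pi.basisFun ℂ (Fin n)).toMatrix_mul_toMatrix_flip b
  refine ⟨⟨(Pi.basisFun ℂ (Fin n)).toMatrix b, b.toMatrix (Pi.basisFun ℂ (Fin n)), hT2, hT1⟩, l,
    LinearMap.toMatrix b b (f - S), ⟨n, ?_⟩, ?_, ?_⟩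
  · rw [LinearMap.toMatrix_pow, hnil, map_zero]
  · intro i j hij
    rw [LinearMap.toMatrix_apply] at hij
    refine hrepr (l j) _ ?_ i hij
    have := hmaps (l j) (l j) _ (hmem j)
    rwa [LinearMap.sub_apply, Module.algebraMap_end_apply, ← hS] at this
  · have h1 : Matrix.diagonal l + LinearMap.toMatrix b b (f - S) = LinearMap.toMatrix b b f := by
      simp [S]
    rw [h1]
    change B * (Pi.basisFun ℂ (Fin n)).toMatrix b = (Pi.basisFun ℂ (Fin n)).toMatrix b * _
    rw [basis_toMatrix_mul_linearMap_toMatrix]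
    have : B = LinearMap.toMatrix (Pi.basisFun ℂ (Fin n)) (Pi.basisFun ℂ (Fin n)) f := by
      rw [hf]; exact (LinearMap.toMatrix'_toLin' B).symm
    conv_lhs => rw [this]
    rw [linearMap_toMatrix_mul_basis_toMatrix]

/-- If `c • C = (D + N) C - C (E + M)` with `D`, `E` diagonal, `N`, `M` nilpotent and commuting with
`D`, `E` respectively, then `C` is supported on the entries with `c = Dᵢ - Eⱼ`. -/
lemma Matrix.apply_eq_zero_of_smul_eq_mul_sub_mul {n : ℕ} {l m : Fin n → ℂ}
    {N M C : Matrix (Fin n) (Fin n) ℂ} (hN : IsNilpotent N) (hM : IsNilpotent M)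
    (hlN : ∀ i j, N i j ≠ 0 → l i = l j) (hmM : ∀ i j, M i j ≠ 0 → m i = m j) {c : ℂ}
    (hC : c • C = (Matrix.diagonal l + N) * C - C * (Matrix.diagonal m + M))
    {i j : Fin n} (hij : l i - m j ≠ c) : C i j = 0 := by
  let Φ : Module.End ℂ (Matrix (Fin n) (Fin n) ℂ) :=
    LinearMap.mulLeft ℂ N - LinearMap.mulRight ℂ M
  have hΦ : IsNilpotent Φ :=
    (LinearMap.commute_mulLeft_right N M).isNilpotent_sub
      ((LinearMap.isNilpotent_mulLeft_iff ℂ N).2 hN) ((LinearMap.isNilpotent_mulRight_iff ℂ M).2 hM)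
  have hstep : ∀ C : Matrix (Fin n) (Fin n) ℂ, ∀ g : ℂ → ℂ, ∀ i j,
      Φ (Matrix.of fun i j => g (l i - m j) * C i j) i j = g (l i - m j) * Φ C i j := by
    intro C g i j
    simp only [Φ, LinearMap.sub_apply, LinearMap.mulLeft_apply, LinearMap.mulRight_apply,
      Matrix.sub_apply, Matrix.mul_apply, Matrix.of_apply, mul_sub, Finset.mul_sum]
    congr 1
    · refine Finset.sum_congr rfl fun k _ => ?_
      by_cases h : N i k = 0
      · simp [h]
      · rw [hlN i k h]; ring
    · refine Finset.sum_congr rfl fun k _ => ?_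
      by_cases h : M k j = 0
      · simp [h]
      · rw [hmM k j h]; ring
  have hbase : Φ C = Matrix.of fun i j => (c - (l i - m j)) * C i j := by
    ext i j
    have := congrFun (congrFun hC i) j
    simp only [add_mul, mul_add, Matrix.smul_apply, Matrix.sub_apply, Matrix.add_apply,
      Matrix.diagonal_mul, Matrix.mul_diagonal, smul_eq_mul] at this
    simp only [Φ, LinearMap.sub_apply, LinearMap.mulLeft_apply, LinearMap.mulRight_apply,
      Matrix.sub_apply, Matrix.of_apply]
    linear_combination -this
  have hpow : ∀ k : ℕ, (Φ ^ k) C = Matrix.of fun i j => (c - (l i - m j)) ^ k * C i j := by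
    intro k
    induction k with
    | zero => ext; simp
    | succ k ih =>
      rw [pow_succ', Module.End.mul_apply, ih]
      ext i j
      rw [hstep C (fun z => (c - z) ^ k), hbase]
      simp only [Matrix.of_apply]
      ring
  obtain ⟨k, hk⟩ := hΦ
  have := congrFun (congrFun (hpow k) i) j
  rw [hk] at this
  simp only [LinearMap.zero_apply, Matrix.zero_apply, Matrix.of_apply, zero_eq_mul] at this
  exact this.resolve_left (pow_ne_zero _ (sub_ne_zero.2 hij.symm))

/-- A choice of coordinates along the orbits of a free translation action of a group on a larger
group. -/
lemma AddMonoidHom.exists_equivariant_of_injective {G H : Type*} [AddCommGroup G] [AddCommGroup H]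
    (γ : H →+ G) (hγ : Function.Injective γ) : ∃ φ : G → H, ∀ x k, φ (x + γ k) = φ x + k := by
  have h : ∀ x : G, ∃ k, γ k = x - (QuotientAddGroup.mk x : G ⧸ γ.range).out := fun x => by
    have := QuotientAddGroup.mk_out_eq_add γ.range x
    obtain ⟨⟨_, k, rfl⟩, hk⟩ := this
    exact ⟨-k, by rw [hk]; simp⟩
  choose φ hφ using h
  refine ⟨φ, fun x k => hγ ?_⟩
  have : (QuotientAddGroup.mk (x + γ k) : G ⧸ γ.range) = QuotientAddGroup.mk x := by simp
  rw [map_add, hφ, hφ, this]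
  abel

/-- The measure on the circle for which Fourier coefficients on the torus are computed. -/
noncomputable local instance : MeasureSpace UnitAddCircle := ⟨AddCircle.haarAddCircle⟩

local instance : Measure.IsAddHaarMeasure (volume : Measure UnitAddCircle) :=
  inferInstanceAs (Measure.IsAddHaarMeasure AddCircle.haarAddCircle)

local instance : IsProbabilityMeasure (volume : Measure UnitAddCircle) :=
  inferInstanceAs (IsProbabilityMeasure AddCircle.haarAddCircle)

namespace Torus

variable {d n : ℕ} {ω : Fin d → ℝ}

lemma continuous_flow (ω : Fin d → ℝ) (t : ℝ) : Continuous (flow ω t : Torus d → Torus d) :=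
  continuous_id.add continuous_const

lemma integrable_of_continuous {f : Torus d → ℂ} (hf : Continuous f) : Integrable f :=
  hf.integrable_of_hasCompactSupport (HasCompactSupport.of_compactSpace f)

lemma integral_derivative_along_flow_eq_zero {f g : Torus d → ℂ} (hf : Continuous f)
    (hg : Continuous g) (hd : ∀ θ, HasDerivAt (fun t : ℝ => f (flow ω t θ)) (g θ) 0) :
    ∫ θ, g θ = 0 := by
  obtain ⟨C, hC⟩ := isCompact_univ.exists_bound_of_continuousOn hg.continuousOn
  have h := (hasDerivAt_integral_of_dominated_loc_of_deriv_le (μ := (volume : Measure (Torus d)))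
    (F := fun t θ => f (flow ω t θ)) (F' := fun t θ => g (flow ω t θ)) (x₀ := (0 : ℝ))
    (bound := fun _ => C) Filter.univ_mem
    (.of_forall fun t => (hf.comp (continuous_flow ω t)).aestronglyMeasurable)
    (integrable_of_continuous (hf.comp (continuous_flow ω 0)))
    (hg.comp (continuous_flow ω 0)).aestronglyMeasurable
    (.of_forall fun θ t _ => hC _ (Set.mem_univ _)) (integrable_const C)
    (.of_forall fun θ t _ => hasDerivAt_flow_of_zero hd θ t)).2
  have hconst : (fun t : ℝ => ∫ θ, f (flow ω t θ)) = fun _ => ∫ θ, f θ := by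
    funext t
    exact integral_add_right_eq_self f (proj (t • ω))
  rw [hconst] at h
  simp only [flow_zero] at h
  exact h.unique (hasDerivAt_const _ _)

lemma mFourierCoeff_derivative_along_flow {f g : Torus d → ℂ} (hf : Continuous f)
    (hg : Continuous g) (hd : ∀ θ, HasDerivAt (fun t : ℝ => f (flow ω t θ)) (g θ) 0)
    (k : Fin d → ℤ) :
    UnitAddTorus.mFourierCoeff g k = (2 * Real.pi * Complex.I * (∑ i, (k i : ℝ) * ω i : ℝ)) *
      UnitAddTorus.mFourierCoeff f k := by
  set c : ℂ := 2 * Real.pi * Complex.I * (∑ i, (k i : ℝ) * ω i : ℝ) with hc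
  have he : Continuous (UnitAddTorus.mFourier (-k)) := (UnitAddTorus.mFourier (-k)).continuous
  have h := integral_derivative_along_flow_eq_zero (ω := ω)
    (f := fun θ => UnitAddTorus.mFourier (-k) θ * f θ)
    (g := fun θ => UnitAddTorus.mFourier (-k) θ * g θ - c * (UnitAddTorus.mFourier (-k) θ * f θ))
    (he.mul hf) ((he.mul hg).sub (continuous_const.mul (he.mul hf))) fun θ => by
      refine ((hasDerivAt_mFourier_flow (-k) ω θ).fun_mul (hd θ)).congr_deriv ?_
      simp only [flow_zero, hc, Pi.neg_apply, Int.cast_neg, neg_mul, Finset.sum_neg_distrib,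
        Complex.ofReal_neg]
      ring
  have hfi : Integrable fun θ => UnitAddTorus.mFourier (-k) θ * f θ :=
    integrable_of_continuous (he.mul hf)
  have hgi : Integrable fun θ => UnitAddTorus.mFourier (-k) θ * g θ :=
    integrable_of_continuous (he.mul hg)
  rw [integral_sub hgi (hfi.const_mul c), integral_const_mul, sub_eq_zero] at h
  simpa only [UnitAddTorus.mFourierCoeff, smul_eq_mul] using h

lemma mFourierCoeff_sum_mul {ι : Type*} (s : Finset ι) (a : ι → ℂ) {f : ι → Torus d → ℂ}
    (hf : ∀ i, Continuous (f i)) (k : Fin d → ℤ) :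
    UnitAddTorus.mFourierCoeff (fun θ => ∑ i ∈ s, a i * f i θ) k
      = ∑ i ∈ s, a i * UnitAddTorus.mFourierCoeff (f i) k := by
  simp only [UnitAddTorus.mFourierCoeff, smul_eq_mul, Finset.mul_sum]
  have he : Continuous (UnitAddTorus.mFourier (-k)) := (UnitAddTorus.mFourier (-k)).continuous
  have hi : ∀ i ∈ s, Integrable fun θ => UnitAddTorus.mFourier (-k) θ * (a i * f i θ) :=
    fun i _ => integrable_of_continuous (he.mul (continuous_const.mul (hf i)))
  rw [integral_finsetSum _ hi]
  refine Finset.sum_congr rfl fun i _ => ?_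
  rw [← integral_const_mul]
  congr 1 with θ
  ring

/-- A solution of `∂_ω W = (D + N) W - W (E + M)`, with `D`, `E` diagonal and `N`, `M` nilpotent
commuting with them, has Fourier coefficients only at the resonances of `D` and `E`. -/
lemma resonant_of_mFourierCoeff_ne_zero {W : Torus d → Matrix (Fin n) (Fin n) ℂ}
    (hW : Continuous W) {l m : Fin n → ℂ} {N M : Matrix (Fin n) (Fin n) ℂ}
    (hN : IsNilpotent N) (hM : IsNilpotent M)
    (hlN : ∀ i j, N i j ≠ 0 → l i = l j) (hmM : ∀ i j, M i j ≠ 0 → m i = m j)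
    (hd : ∀ θ, HasDerivAt (fun t : ℝ => W (flow ω t θ))
      ((Matrix.diagonal l + N) * W θ - W θ * (Matrix.diagonal m + M)) 0)
    {i j : Fin n} {k : Fin d → ℤ} (hk : UnitAddTorus.mFourierCoeff (fun θ => W θ i j) k ≠ 0) :
    l i - m j = 2 * Real.pi * Complex.I * (∑ i, (k i : ℝ) * ω i : ℝ) := by
  by_contra hne
  have hWij : ∀ i j, Continuous fun θ => W θ i j := fun i j => hW.matrix_elem i j
  refine hk (Matrix.apply_eq_zero_of_smul_eq_mul_sub_mul hN hM hlN hmM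
    (C := Matrix.of fun i j => UnitAddTorus.mFourierCoeff (fun θ => W θ i j) k) ?_ hne)
  ext i j
  have h := mFourierCoeff_derivative_along_flow (ω := ω) (hWij i j)
    (g := fun θ => ((Matrix.diagonal l + N) * W θ - W θ * (Matrix.diagonal m + M)) i j)
    ((((continuous_const.matrix_mul hW).sub (hW.matrix_mul continuous_const)).matrix_elem i j))
    (fun θ => Matrix.hasDerivAt_iff.1 (hd θ) i j) k
  rw [Matrix.smul_apply, Matrix.of_apply, smul_eq_mul, ← h]
  simp only [Matrix.sub_apply, Matrix.mul_apply, Matrix.of_apply]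
  have h2 := mFourierCoeff_sum_mul Finset.univ
    (Sum.elim (fun x => (Matrix.diagonal l + N) i x) (fun x => - (Matrix.diagonal m + M) x j))
    (f := Sum.elim (fun x θ => W θ x j) (fun x θ => W θ i x))
    (by rintro (x | x) <;> exact hWij _ _) k
  simpa only [Fintype.sum_sum_type, Sum.elim_inl, Sum.elim_inr, neg_mul, Finset.sum_neg_distrib,
    ← sub_eq_add_neg, mul_comm (W _ _ _) _, mul_comm (UnitAddTorus.mFourierCoeff _ _) _] using h2

/-- A continuous function with at most one nonzero Fourier coefficient is a multiple of the
corresponding character. -/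
lemma eq_mFourierCoeff_mul_mFourier {f : Torus d → ℂ} (hf : Continuous f) (k : Fin d → ℤ)
    (h : ∀ k', k' ≠ k → UnitAddTorus.mFourierCoeff f k' = 0) (θ : Torus d) :
    f θ = UnitAddTorus.mFourierCoeff f k * UnitAddTorus.mFourier k θ := by
  have hs : Summable (UnitAddTorus.mFourierCoeff (⟨f, hf⟩ : C(Torus d, ℂ))) :=
    summable_of_ne_finset_zero (s := {k}) fun k' hk' => h k' (by simpa using hk')
  refine (UnitAddTorus.hasSum_mFourier_series_apply_of_summable hs θ).unique ?_
  refine hasSum_single k fun k' hk' => ?_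
  have : UnitAddTorus.mFourierCoeff (⟨f, hf⟩ : C(Torus d, ℂ)) k' = 0 := h k' hk'
  rw [this, zero_smul]

end Torus

lemma RationallyIndependent.injective {d : ℕ} {ω : Fin d → ℝ} (hω : RationallyIndependent ω)
    {k k' : Fin d → ℤ} (h : ∑ i, (k i : ℝ) * ω i = ∑ i, (k' i : ℝ) * ω i) : k = k' := by
  by_contra hne
  refine hω (k - k') (sub_ne_zero.2 hne) ?_
  simp [sub_mul, h]

/-- Each frequency `x` has half of an integer vector, `M x / 2`, attached to it so that resonant
frequencies, those with `x + y = 2π⟨k, ω⟩`, satisfy `M x / 2 + M y / 2 = k`. -/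
lemma RationallyIndependent.exists_resonance_splitting {d : ℕ} {ω : Fin d → ℝ}
    (hω : RationallyIndependent ω) : ∃ M : ℝ → (Fin d → ℤ), ∀ x y k,
      x + y = 2 * Real.pi * ∑ i, (k i : ℝ) * ω i → M x + M y = k + k := by
  let γ : (Fin d → ℤ) →+ ℝ :=
    { toFun := fun k => 2 * Real.pi * ∑ i, (k i : ℝ) * ω i
      map_zero' := by simp
      map_add' := fun k k' => by simp [add_mul, Finset.sum_add_distrib, mul_add] }
  have hγ : Function.Injective γ := fun k k' h =>
    hω.injective (mul_left_cancel₀ (by positivity) h)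
  obtain ⟨φ, hφ⟩ := γ.exists_equivariant_of_injective hγ
  refine ⟨fun x => φ x - φ (-x), fun x y k h => ?_⟩
  change x + y = γ k at h
  have h1 := hφ (-x) k
  have h2 := hφ (-y) k
  rw [show -x + γ k = y by rw [← h]; ring] at h1
  rw [show -y + γ k = x by rw [← h]; ring] at h2
  change φ x - φ (-x) + (φ y - φ (-y)) = k + k
  rw [h1, h2]
  abel

lemma Matrix.GeneralLinearGroup.continuous_coe_inv {X : Type*} [TopologicalSpace X] {n : ℕ}
    {Z : X → GL (Fin n) ℂ} (hZ : Continuous fun x => (Z x : Matrix (Fin n) (Fin n) ℂ)) :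
    Continuous fun x => ((Z x)⁻¹ : GL (Fin n) ℂ).val := by
  simp only [← Ring.inverse_unit]
  exact continuous_iff_continuousAt.2 fun x =>
    (NormedRing.inverse_continuousAt (Z x)).comp (f := fun x => (Z x).val) hZ.continuousAt

namespace IsConjugation

variable {d n : ℕ} {ω : Fin d → ℝ} {A : Torus d → Matrix (Fin n) (Fin n) ℂ}
  {B : Matrix (Fin n) (Fin n) ℂ} {Z : Torus d → GL (Fin n) ℂ}

lemma hasDerivAt_flow (h : IsConjugation ω A (fun _ => B) Z) (θ : Torus d) :
    HasDerivAt (fun t : ℝ => (Z (Torus.flow ω t θ)).val) (A θ * Z θ - Z θ * B) 0 := by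
  obtain ⟨hZ, X, Y, hX, hY, hXY⟩ := h
  obtain ⟨D, hD⟩ : ∃ D, HasDerivAt (fun t : ℝ => (Z (Torus.flow ω t θ)).val) D 0 :=
    ⟨_, (hZ.differentiableAt_flow ω θ 0).hasDerivAt⟩
  have hXd := Matrix.hasDerivAt_iff.2 (hX.deriv θ 0)
  have hYd := Matrix.hasDerivAt_iff.2 (hY.deriv θ 0)
  have h1 := ((hD.fun_mul hYd).mul_const ((Z θ)⁻¹ : GL (Fin n) ℂ).val).congr_of_eventuallyEq
    (.of_forall fun t => hXY t θ)
  have h2 := hXd.unique h1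
  simp only [Torus.flow_zero, hX.zero, hY.zero, mul_one] at h2
  have h3 : A θ * Z θ = D + Z θ * B := by rw [h2, mul_assoc, Units.inv_mul, mul_one]
  rwa [h3, add_sub_cancel_right]

lemma of_hasDerivAt_flow (hZ : SmoothOnTorus fun θ => (Z θ).val)
    (hd : ∀ θ, HasDerivAt (fun t : ℝ => (Z (Torus.flow ω t θ)).val) (A θ * Z θ - Z θ * B) 0) :
    IsConjugation ω A (fun _ => B) Z := by
  have hexp := fun t : ℝ => hasDerivAt_exp_smul_const' (𝕂 := ℝ) B t
  refine ⟨hZ, _, fun t _ => NormedSpace.exp (t • B), ⟨?_, ?_⟩, ⟨by simp, ?_⟩, fun t θ => rfl⟩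
  · intro θ
    simp [Torus.flow_zero]
  · intro θ t
    refine Matrix.hasDerivAt_iff.1 ?_
    refine (((Torus.hasDerivAt_flow_of_zero (F := fun θ => (Z θ).val)
      (F' := fun θ => A θ * Z θ - Z θ * B) hd θ t).fun_mul (hexp t)).mul_const _).congr_deriv ?_
    noncomm_ring
  · exact fun θ t => Matrix.hasDerivAt_iff.1 (hexp t)

end IsConjugation

/-- Let `∂_ω Z = A Z - Z (D + N)`, with `A` real, `D` diagonal and `N` nilpotent commuting with `D`.
Twisting `Z(2θ)` by suitable characters gives a conjugation on the doubled torus which is real up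
to a constant factor. -/
lemma RationallyIndependent.exists_constant_conj_quotient {d n : ℕ} {ω : Fin d → ℝ}
    (hω : RationallyIndependent ω) {A : Torus d → Matrix (Fin n) (Fin n) ℂ}
    (hA : ∀ θ, (A θ).map conj = A θ) {Z : Torus d → GL (Fin n) ℂ}
    (hZ : SmoothOnTorus fun θ => (Z θ).val)
    {l : Fin n → ℂ} {N : Matrix (Fin n) (Fin n) ℂ} (hN : IsNilpotent N)
    (hlN : ∀ i j, N i j ≠ 0 → l i = l j)
    (hd : ∀ θ, HasDerivAt (fun t : ℝ => (Z (Torus.flow ω t θ)).val)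
      (A θ * Z θ - Z θ * (Matrix.diagonal l + N)) 0) :
    ∃ (Z' : Torus d → GL (Fin n) ℂ) (B : Matrix (Fin n) (Fin n) ℂ) (C : GL (Fin n) ℂ),
      SmoothOnTorus (fun θ => (Z' θ).val) ∧
      (∀ θ, HasDerivAt (fun t : ℝ => (Z' (Torus.flow ((1 / 2 : ℝ) • ω) t θ)).val)
        (A ((2 : ℕ) • θ) * Z' θ - Z' θ * B) 0) ∧
      ∀ θ, (Z' θ)⁻¹ * Matrix.GeneralLinearGroup.map conj (Z' θ) = C := by
  set J := Matrix.diagonal l + N with hJ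
  let σ : GL (Fin n) ℂ →* GL (Fin n) ℂ := Matrix.GeneralLinearGroup.map (starRingEnd ℂ)
  have hσ : ∀ g : GL (Fin n) ℂ, (σ g).val = g.val.map conj := fun _ => rfl
  -- `W` is the defect of reality of `Z`
  let W : Torus d → GL (Fin n) ℂ := fun θ => (Z θ)⁻¹ * σ (Z θ)
  have hZcont := hZ.continuous
  have hWcont : Continuous fun θ => (W θ).val :=
    (Matrix.GeneralLinearGroup.continuous_coe_inv hZcont).matrix_mul
      (hZcont.matrix_map Complex.continuous_conj)
  have hσd : ∀ θ, HasDerivAt (fun t : ℝ => (σ (Z (Torus.flow ω t θ))).val)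
      (A θ * (σ (Z θ)).val - (σ (Z θ)).val * J.map conj) 0 := fun θ => by
    refine Matrix.hasDerivAt_iff.2 fun i j => ?_
    have h := (Matrix.hasDerivAt_iff.1 (hd θ) i j).star
    refine h.congr_deriv ?_
    have h2 : (A θ * (Z θ).val - (Z θ).val * J).map conj
        = A θ * (σ (Z θ)).val - (σ (Z θ)).val * J.map conj := by
      rw [Matrix.map_sub _ (map_sub _), Matrix.map_mul, Matrix.map_mul, hA, hσ]
    exact congrFun (congrFun h2 i) j
  have hJconj : J.map conj = Matrix.diagonal (fun i => conj (l i)) + N.map conj := by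
    rw [hJ, Matrix.map_add _ (map_add _), Matrix.diagonal_map (map_zero _)]
  have hWd : ∀ θ, HasDerivAt (fun t : ℝ => (W (Torus.flow ω t θ)).val)
      ((Matrix.diagonal l + N) * W θ
        - W θ * (Matrix.diagonal (fun i => conj (l i)) + N.map conj)) 0 := fun θ => by
    refine ((hd θ).units_inv.fun_mul (hσd θ)).congr_deriv ?_
    have e1 : ((Z θ)⁻¹ : GL (Fin n) ℂ).val * (Z θ).val = 1 := Units.inv_mul _
    have e2 : (Z θ).val * ((Z θ)⁻¹ : GL (Fin n) ℂ).val = 1 := Units.mul_inv _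
    rw [← hJconj, ← hJ]
    simp only [Torus.flow_zero, W, Units.val_mul]
    simp only [mul_sub, sub_mul, neg_sub]
    rw [← mul_assoc _ (Z θ).val J, e1, one_mul, mul_assoc _ (A θ * _) _, mul_assoc (A θ), e2,
      mul_one]
    noncomm_ring
  obtain ⟨M, hM⟩ := hω.exists_resonance_splitting
  let m : Fin n → Fin d → ℤ := fun i => M (l i).im
  let e : (Fin d → ℤ) → Torus d → ℂ := fun k θ => UnitAddTorus.mFourier k θ
  have he : ∀ k θ, e k θ * e (-k) θ = 1 := fun k θ => by
    simp only [e]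
    rw [← UnitAddTorus.mFourier_add, add_neg_cancel, UnitAddTorus.mFourier_zero]
    rfl
  have hconst : ∀ i j, ∃ c : ℂ, ∀ θ,
      e (-(m i)) θ * (W ((2 : ℕ) • θ)).val i j * e (-(m j)) θ = c := by
    intro i j
    have hWij : Continuous fun θ => (W θ).val i j := hWcont.matrix_elem i j
    have hres := fun k hk => Torus.resonant_of_mFourierCoeff_ne_zero (k := k) (i := i) (j := j)
      hWcont hN (hN.map (starRingEnd ℂ).mapMatrix) hlN (m := fun i => conj (l i))
      (fun i j hij => by rw [hlN i j fun h => hij (by simp [h])]) hWd hk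
    have him : ∀ k : Fin d → ℤ, UnitAddTorus.mFourierCoeff (fun θ => (W θ).val i j) k ≠ 0 →
        (l i).im + (l j).im = 2 * Real.pi * ∑ i, (k i : ℝ) * ω i := fun k hk => by
      have h1 := congrArg Complex.im (hres k hk)
      have h2 : (2 * Real.pi * Complex.I * (∑ i, (k i : ℝ) * ω i : ℝ) : ℂ).im
          = 2 * Real.pi * ∑ i, (k i : ℝ) * ω i := by
        rw [show (2 * Real.pi * Complex.I * (∑ i, (k i : ℝ) * ω i : ℝ) : ℂ)
          = ((2 * Real.pi * ∑ i, (k i : ℝ) * ω i : ℝ) : ℂ) * Complex.I by push_cast; ring]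
        rw [Complex.im_ofReal_mul, Complex.I_im, mul_one]
      rw [h2] at h1
      simpa using h1
    by_cases hk : ∃ k, UnitAddTorus.mFourierCoeff (fun θ => (W θ).val i j) k ≠ 0
    · obtain ⟨k, hk⟩ := hk
      refine ⟨UnitAddTorus.mFourierCoeff (fun θ => (W θ).val i j) k, fun θ => ?_⟩
      have huniq : ∀ k', k' ≠ k → UnitAddTorus.mFourierCoeff (fun θ => (W θ).val i j) k' = 0 := by
        intro k' hk'
        by_contra hne
        refine hk' (hω.injective ?_)
        have := (him k' hne).symm.trans (him k hk)
        exact mul_left_cancel₀ (by positivity) this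
      have hW := Torus.eq_mFourierCoeff_mul_mFourier hWij k huniq ((2 : ℕ) • θ)
      rw [hW, Torus.mFourier_two_nsmul, ← hM _ _ k (him k hk), UnitAddTorus.mFourier_add]
      have h1 := he (m i) θ
      have h2 := he (m j) θ
      simp only [e, m] at h1 h2 ⊢
      generalize UnitAddTorus.mFourierCoeff (fun θ => (W θ).val i j) k = c
      linear_combination c * h1 + c * (UnitAddTorus.mFourier (M (l i).im) θ *
        UnitAddTorus.mFourier (-M (l i).im) θ) * h2
    · push Not at hk
      refine ⟨0, fun θ => ?_⟩
      rw [Torus.eq_mFourierCoeff_mul_mFourier hWij 0 (fun k' _ => hk k') ((2 : ℕ) • θ), hk]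
      simp
  let U : Torus d → GL (Fin n) ℂ := fun θ =>
    { val := Matrix.diagonal fun i => e (m i) θ
      inv := Matrix.diagonal fun i => e (-(m i)) θ
      val_inv := by simp [Matrix.diagonal_mul_diagonal, he]
      inv_val := by simp [Matrix.diagonal_mul_diagonal, mul_comm (e (-_) _), he] }
  have hU : ∀ θ, (U θ).val = Matrix.diagonal fun i => e (m i) θ := fun _ => rfl
  have hUinv : ∀ θ, ((U θ)⁻¹).val = Matrix.diagonal fun i => e (-(m i)) θ := fun _ => rfl
  have hUσ : ∀ θ, (σ (U θ)).val = Matrix.diagonal fun i => e (-(m i)) θ := fun θ => by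
    rw [hσ, hU, Matrix.diagonal_map (map_zero _)]
    congr 1 with i
    exact UnitAddTorus.mFourier_neg.symm
  have hUJ : ∀ θ, J * (U θ).val = (U θ).val * J := fun θ => by
    rw [hU, hJ, add_mul, mul_add, Matrix.diagonal_mul_diagonal, Matrix.diagonal_mul_diagonal]
    congr 1
    · simp only [mul_comm]
    · ext i j
      rw [Matrix.mul_diagonal, Matrix.diagonal_mul]
      by_cases h : N i j = 0
      · simp [h]
      · simp only [m, hlN i j h, mul_comm]
  have hUsmooth : SmoothOnTorus fun θ => (U θ).val := fun i j => by
    simp only [hU, Matrix.diagonal_apply]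
    split_ifs
    · exact Torus.contDiff_mFourier_proj _
    · exact contDiff_const
  let D : Matrix (Fin n) (Fin n) ℂ := Matrix.diagonal fun i =>
    2 * Real.pi * Complex.I * (∑ a, (m i a : ℝ) * ((1 / 2 : ℝ) • ω) a : ℝ)
  have hUd : ∀ θ, HasDerivAt (fun t : ℝ => (U (Torus.flow ((1 / 2 : ℝ) • ω) t θ)).val)
      ((U θ).val * D) 0 := fun θ => by
    refine Matrix.hasDerivAt_iff.2 fun i j => ?_
    simp only [hU, D, Matrix.diagonal_mul_diagonal, Matrix.diagonal_apply]
    split_ifs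
    · exact (Torus.hasDerivAt_mFourier_flow _ _ θ).congr_deriv (mul_comm _ _)
    · exact hasDerivAt_const _ _
  let Z' : Torus d → GL (Fin n) ℂ := fun θ => Z ((2 : ℕ) • θ) * U θ
  have hquot : ∀ θ, ((Z' θ)⁻¹ * σ (Z' θ)).val
      = ((U θ)⁻¹).val * (W ((2 : ℕ) • θ)).val * (σ (U θ)).val := fun θ => by
    rw [← Units.val_mul, ← Units.val_mul]
    simp only [Z', W, map_mul]
    congr 1
    group
  refine ⟨Z', J - D, (Z' 0)⁻¹ * σ (Z' 0), hZ.two_nsmul.mul hUsmooth, fun θ => ?_, fun θ => ?_⟩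
  · have h1 : HasDerivAt
        (fun t : ℝ => (Z ((2 : ℕ) • Torus.flow ((1 / 2 : ℝ) • ω) t θ)).val)
        (A ((2 : ℕ) • θ) * Z ((2 : ℕ) • θ) - Z ((2 : ℕ) • θ) * J) 0 := by
      simpa only [Torus.two_nsmul_flow_half] using hd ((2 : ℕ) • θ)
    refine (h1.fun_mul (hUd θ)).congr_deriv ?_
    simp only [Torus.flow_zero, Z', Units.val_mul, sub_mul, mul_sub, mul_assoc, hUJ]
    abel
  · refine Units.ext ?_
    change ((Z' θ)⁻¹ * σ (Z' θ)).val = _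
    rw [hquot, hquot]
    ext i j
    rw [hUinv, hUσ, hUinv, hUσ]
    obtain ⟨c, hc⟩ := hconst i j
    simp only [Matrix.mul_diagonal, Matrix.diagonal_mul, hc]

lemma Reducible.exists_real_conjugation {d n : ℕ} {ω : Fin d → ℝ}
    (hω : RationallyIndependent ω) {A : Torus d → Matrix (Fin n) (Fin n) ℂ}
    (hA : ∀ θ, (A θ).map conj = A θ) (hred : Reducible ω A) :
    ∃ (Z : Torus d → GL (Fin n) ℂ) (B : Matrix (Fin n) (Fin n) ℂ),
      SmoothOnTorus (fun θ => (Z θ).val) ∧ IsRealValued (fun θ => (Z θ).val) ∧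
      ∀ θ, HasDerivAt (fun t : ℝ => (Z (Torus.flow ((1 / 2 : ℝ) • ω) t θ)).val)
        (A ((2 : ℕ) • θ) * Z θ - Z θ * B) 0 := by
  obtain ⟨B, Z, hZ⟩ := hred
  obtain ⟨T, l, N, hN, hlN, hBT⟩ := B.exists_conj_eq_diagonal_add_isNilpotent
  have hd : ∀ θ, HasDerivAt (fun t : ℝ => (Z (Torus.flow ω t θ) * T).val)
      (A θ * (Z θ * T).val - (Z θ * T).val * (Matrix.diagonal l + N)) 0 := fun θ => by
    refine ((hZ.hasDerivAt_flow θ).mul_const T.val).congr_deriv ?_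
    simp only [Units.val_mul, sub_mul, mul_assoc, hBT]
  obtain ⟨Z', B', C, hZ', hd', hC⟩ := hω.exists_constant_conj_quotient (Z := fun θ => Z θ * T) hA
    (hZ.1.mul (.const T.val)) hN hlN hd
  refine ⟨fun θ => Z' θ * (Z' 0)⁻¹, (Z' 0).val * B' * ((Z' 0)⁻¹).val,
    hZ'.mul (.const ((Z' 0)⁻¹).val), fun θ i j => ?_, fun θ => ?_⟩
  · have h : Matrix.GeneralLinearGroup.map conj (Z' θ * (Z' 0)⁻¹) = Z' θ * (Z' 0)⁻¹ := by
      have h0 := hC 0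
      have h1 := hC θ
      rw [inv_mul_eq_iff_eq_mul] at h0 h1
      rw [map_mul, map_inv, h0, h1]
      group
    have h2 := congrArg (fun g : GL (Fin n) ℂ => g.val i j) h
    exact Complex.conj_eq_iff_im.1 h2
  · refine ((hd' θ).mul_const ((Z' 0)⁻¹).val).congr_deriv ?_
    simp only [Units.val_mul, sub_mul, mul_assoc, Units.inv_mul_cancel_left]

theorem theorem1 {d n : ℕ} (ω : Fin d → ℝ) (hω : RationallyIndependent ω)
    (A : Torus d → Matrix (Fin n) (Fin n) ℝ) (hA : SmoothOnTorus A)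
    (hred : Reducible ω (fun θ => (A θ).map Complex.ofReal)) :
    RealReducible ((1 / 2 : ℝ) • ω) (fun θ => (A ((2 : ℕ) • θ)).map Complex.ofReal) ∧
    ∃ (Z : Torus d → GL (Fin n) ℝ) (B : Matrix (Fin n) (Fin n) ℝ),
      SmoothOnTorus (fun θ => (Z θ : Matrix (Fin n) (Fin n) ℝ)) ∧
      ∀ θ, HasDirDerivAt ((1 / 2 : ℝ) • ω) (fun θ' => (Z θ' : Matrix (Fin n) (Fin n) ℝ))
        (A ((2 : ℕ) • θ) * (Z θ : Matrix (Fin n) (Fin n) ℝ) - (Z θ : Matrix (Fin n) (Fin n) ℝ) * B)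
        θ := by
  obtain ⟨Z, B, hZ, hreal, hd⟩ := hred.exists_real_conjugation hω fun θ => by ext; simp
  refine ⟨⟨fun θ i j => by simp, B, Z, hreal, .of_hasDerivAt_flow hZ hd⟩, ?_⟩
  have hmap : ∀ θ, ((Z θ).val.map Complex.re).map Complex.ofReal = (Z θ).val := fun θ => by
    ext i j
    exact Complex.ext rfl (hreal θ i j).symm
  have hdet : ∀ θ, ((Z θ).val.map Complex.re).det ≠ 0 := fun θ h => by
    have h1 := Complex.ofRealHom.map_det ((Z θ).val.map Complex.re)
    rw [h, map_zero] at h1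
    refine ((Matrix.isUnit_iff_isUnit_det _).1 (Z θ).isUnit).ne_zero (Eq.trans ?_ h1.symm)
    exact congrArg Matrix.det (hmap θ).symm
  refine ⟨fun θ => Matrix.GeneralLinearGroup.mkOfDetNeZero _ (hdet θ), B.map Complex.re,
    fun i j => Complex.reCLM.contDiff.comp (hZ i j), fun θ i j => ?_⟩
  have h := Complex.reCLM.hasFDerivAt.comp_hasDerivAt 0 (Matrix.hasDerivAt_iff.1 (hd θ) i j)
  refine HasDerivAt.congr_deriv h ?_
  change Complex.re _ = (A _ * (Z θ).val.map Complex.re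
    - (Z θ).val.map Complex.re * B.map Complex.re) i j
  have him : ∀ i j, ((Z θ).val i j).im = 0 := hreal θ
  simp [Matrix.mul_apply, Complex.mul_re, him]
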